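/- Let $\Gamma$ be a discrete group generated by a finite set $S$, with the left-invariant word metric of $S$, and let $L$ be a $\mathbb Z\Gamma$-module. Let $P$ be a connected, finite-dimensional, locally finite simplicial complex with a free simplicial action of $\Gamma$, and let $\alpha:\Gamma\times P\to\mathbb R^n$ be a continuous map such that (1) $\alpha(\gamma g,\gamma x)=\alpha(g,x)$ for all $\gamma,g\in\Gamma$, $x\in P$; (2) for every $g\in\Gamma$ the map $\alpha(g,\cdot):P\to\mathbb R^n$ is proper; (3) for every $x\in P$ the map $\alpha(\cdot,x):\Gamma\to\mathbb R^n$ is $1$-Lipschitz for the word metric on $\Gamma$. Let $\Delta^\infty(\Gamma)$ be the simplex spanned by $\Gamma$ and let $\bar\alpha:\Delta^\infty(\Gamma)\times P\to\mathbb R^n$ be the extension $\bar\alpha(\sum_i t_i\gamma_i,x)=\sum_i t_i\,\alpha(\gamma_i,x)$. Let $\omega$ be a compactly supported integral singular $n$-cocycle on $\mathbb R^n$ whose class generates $H^n_c(\mathbb R^n;\mathbb Z)$. For an ordered simplex $\Delta=[\gamma_0,\dots,\gamma_k]$ of $\Delta^\infty(\Gamma)$ and an ordered $(n-k)$-simplex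 $\sigma$ of $P$ put $\phi(\Delta\otimes\sigma)=\omega(\bar\alpha|_{\Delta\times\sigma})$, where $\bar\alpha|_{\Delta\times\sigma}$ is regarded as a singular $n$-chain through the staircase triangulation of $\Delta\times\sigma$. Let $H_*(P:\Gamma;L)$ be the homology of the complex of infinite $\Gamma$-invariant simplicial chains $z=\sum_\sigma\lambda_\sigma\sigma$ on $P$ (sums over ordered simplices), with $\lambda_\sigma\in L$ and $\lambda_{\gamma\sigma}=\gamma\lambda_\sigma$. The homomorphism $$\alpha_\cap:H_{n-k}(P:\Gamma;L)\to H^k(\Gamma,L)$$ sends the class of a cycle $z=\sum_\sigma\lambda_\sigma\sigma$ to the class of the cocycle $[\gamma_0,\dots,\gamma_k]\mapsto\sum_\sigma\phi([\gamma_0,\dots,\gamma_k]\otimes\sigma)\,\lambda_\sigma$ (a finite sum). A class in $H^k(\Gamma,L)$ is called proper Lipschitz if it lies in the image of $\alpha_\cap$ for some $P$, $n$, $\alpha$, $\omega$ as above. **Theorem.** Let $h:L\to L'$ be a homomorphism of $\mathbb Z\Gamma$-modules, and let $h_*:H^k(\Gamma,L)\to H^k(\Gamma,L')$ be the induced homomorphism.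 If $a\in H^k(\Gamma,L)$ is a proper Lipschitz class, then $h_*(a)\in H^k(\Gamma,L')$ is a proper Lipschitz class. -/

import Mathlib

noncomputable section

namespace ProperLipschitz

open CategoryTheory

/-! ### Simplicial complexes, ordered simplices, geometric realization -/

section Complexes

variable {V : Type} (K : AbstractSimplicialComplex V)

/-- Ordered `m`-simplices of `K`: tuples `(v₀, …, vₘ)` of vertices (repetitions allowed) all of
which lie in a common simplex of `K`. -/
def OrderedSimplex (m : ℕ) : Type :=
  {v : Fin (m + 1) → V // ∃ s ∈ K.faces, ∀ i, v i ∈ s}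

/-- The `i`-th face `(v₀, …, v̂ᵢ, …, vₘ₊₁)`. -/
def OrderedSimplex.face {K : AbstractSimplicialComplex V} {m : ℕ} (i : Fin (m + 2))
    (σ : OrderedSimplex K (m + 1)) : OrderedSimplex K m :=
  ⟨σ.1 ∘ i.succAbove, by
    obtain ⟨s, hs, h⟩ := σ.2
    exact ⟨s, hs, fun j => h _⟩⟩

/-- The geometric realization of `K`: points are given by their barycentric coordinates. -/
def Realization : Type :=
  {x : V →₀ ℝ // (∀ v, 0 ≤ x v) ∧ (x.sum fun _ t => t) = 1 ∧ x.support ∈ K.faces}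

/-- The point with barycentric coordinates `t` with respect to the vertices `v₀, …, vₘ`,
as a finitely supported function: `∑ᵢ tᵢ vᵢ`. -/
def baryPoint {W : Type} {m : ℕ} (v : Fin (m + 1) → W) (t : stdSimplex ℝ (Fin (m + 1))) :
    W →₀ ℝ :=
  ∑ i, Finsupp.single (v i) (t i)

lemma baryPoint_nonneg {W : Type} {m : ℕ} (v : Fin (m + 1) → W)
    (t : stdSimplex ℝ (Fin (m + 1))) (w : W) : 0 ≤ baryPoint v t w := by
  classical
  rw [baryPoint, Finsupp.finsetSum_apply]
  refine Finset.sum_nonneg fun i _ => ?_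
  rw [Finsupp.single_apply]
  split_ifs
  · exact t.2.1 i
  · exact le_rfl

lemma baryPoint_linear {W : Type} {E : Type} [AddCommGroup E] [Module ℝ E] {m : ℕ}
    (v : Fin (m + 1) → W) (t : stdSimplex ℝ (Fin (m + 1))) (f : W → E) :
    ((baryPoint v t).sum fun w r => r • f w) = ∑ i, t i • f (v i) := by
  classical
  rw [baryPoint, ← Finsupp.sum_finsetSum_index (by simp) (by intros; rw [add_smul])]
  simp

lemma baryPoint_sum {W : Type} {m : ℕ} (v : Fin (m + 1) → W)
    (t : stdSimplex ℝ (Fin (m + 1))) : ((baryPoint v t).sum fun _ r => r) = 1 := by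
  have h := baryPoint_linear v t (fun _ => (1 : ℝ))
  simp only [smul_eq_mul, mul_one] at h
  rw [h]
  exact t.2.2

variable {K}

/-- The characteristic map `|Δᵐ| → |K|` of an ordered simplex (the affine map sending the `i`-th
vertex to `vᵢ`). -/
def OrderedSimplex.charMap {m : ℕ} (σ : OrderedSimplex K m) (t : stdSimplex ℝ (Fin (m + 1))) :
    Realization K :=
  ⟨baryPoint σ.1 t, baryPoint_nonneg _ _, baryPoint_sum _ _, by
    classical
    obtain ⟨s, hs, h⟩ := σ.2
    refine (K.isRelLowerSet_faces hs).2 ?_ ?_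
    · intro w hw
      rw [Finsupp.mem_support_iff, baryPoint, Finsupp.finsetSum_apply] at hw
      obtain ⟨i, -, hi⟩ := Finset.exists_ne_zero_of_sum_ne_zero hw
      rw [Finsupp.single_apply] at hi
      split_ifs at hi with hv
      · exact hv ▸ h i
      · exact absurd rfl hi
    · rw [Finsupp.support_nonempty_iff]
      intro h0
      have h1 := baryPoint_sum σ.1 t
      rw [h0, Finsupp.sum_zero_index] at h1
      exact zero_ne_one h1⟩

/-- The weak topology on `|K|`: a set is open iff its preimage under the characteristic map of
every simplex is open. -/
instance : TopologicalSpace (Realization K) :=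
  ⨆ (m : ℕ) (σ : OrderedSimplex K m), TopologicalSpace.coinduced σ.charMap inferInstance

lemma OrderedSimplex.continuous_charMap {m : ℕ} (σ : OrderedSimplex K m) :
    Continuous σ.charMap :=
  continuous_iff_coinduced_le.2
    (le_iSup₂ (f := fun (m : ℕ) (σ : OrderedSimplex K m) =>
      TopologicalSpace.coinduced σ.charMap inferInstance) m σ)

end Complexes

/-! ### Simplicial `Γ`-complexes -/

/-- A simplicial complex with a simplicial action of `Γ`. Connected locally finite complexes have
countably many vertices, so taking the vertex set in `Type` is no restriction for them. -/
structure GammaComplex (Γ : Type) [Group Γ] where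
  V : Type
  [action : MulAction Γ V]
  K : AbstractSimplicialComplex V
  map_mem : ∀ (γ : Γ), ∀ s ∈ K.faces, s.map (MulAction.toPerm γ).toEmbedding ∈ K.faces

attribute [instance] GammaComplex.action

namespace GammaComplex

variable {Γ : Type} [Group Γ] (P : GammaComplex Γ)

/-- The geometric realization `|P|`. -/
abbrev Space : Type := Realization P.K

/-- The action of `Γ` on ordered simplices. -/
def smulSimplex {P : GammaComplex Γ} (γ : Γ) {m : ℕ} (σ : OrderedSimplex P.K m) :
    OrderedSimplex P.K m :=
  ⟨fun i => γ • σ.1 i, by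
    obtain ⟨s, hs, h⟩ := σ.2
    exact ⟨_, P.map_mem γ s hs, fun i => Finset.mem_map_of_mem _ (h i)⟩⟩

/-- The action of `Γ` on `|P|`: `γ · ∑ tᵥ v = ∑ tᵥ (γ v)`. -/
def smulPoint {P : GammaComplex Γ} (γ : Γ) (x : P.Space) : P.Space :=
  ⟨x.1.embDomain (MulAction.toPerm γ).toEmbedding, by
    refine ⟨fun v => ?_, ?_, ?_⟩
    · obtain ⟨w, rfl⟩ := (MulAction.toPerm γ).surjective v
      exact (Finsupp.embDomain_apply_self (MulAction.toPerm γ).toEmbedding x.1 w).symm ▸ x.2.1 w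
    · rw [Finsupp.sum_embDomain]
      exact x.2.2.1
    · rw [Finsupp.support_embDomain]
      exact P.map_mem γ _ x.2.2.2⟩

/-- The requirements on a parameter complex: `|P|` is connected, `P` is finite-dimensional and
locally finite, and the action of `Γ` on `|P|` is free. -/
structure IsAdmissible : Prop where
  connected : ConnectedSpace P.Space
  finiteDimensional : ∃ d : ℕ, ∀ s ∈ P.K.faces, s.card ≤ d + 1
  locallyFinite : ∀ v : P.V, {s ∈ P.K.faces | v ∈ s}.Finite
  free : ∀ (γ : Γ) (x : P.Space), smulPoint γ x = x → γ = 1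

end GammaComplex

/-! ### Infinite invariant chains -/

section Chains

variable {Γ : Type} [Group Γ] (P : GammaComplex Γ) (L : Rep.{0} ℤ Γ)

/-- Infinite `Γ`-invariant `m`-chains `∑ λ_σ σ` on `P` with coefficients in `L`, i.e. families
`λ_σ ∈ L` with `λ_{γσ} = γ λ_σ`. Ordered simplices are used (ordered and oriented chains have the
same homology), since the triangulation of `Δ × σ` needs an ordering of the vertices of `σ`. -/
def invariantChains (m : ℕ) : AddSubgroup (OrderedSimplex P.K m → L) where
  carrier := {c | ∀ (γ : Γ) (σ : OrderedSimplex P.K m),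
    c (GammaComplex.smulSimplex γ σ) = L.ρ γ (c σ)}
  zero_mem' := by intro γ σ; simp
  add_mem' := by intro a b ha hb γ σ; simp [ha γ σ, hb γ σ]
  neg_mem' := by intro a ha γ σ; simp [ha γ σ]

/-- The boundary of an infinite chain: the coefficient of `∂ (∑ λ_σ σ)` at `τ` is
`∑ᵢ (-1)ⁱ ∑_{σ : dᵢ σ = τ} λ_σ` (a finite sum if `P` is locally finite). -/
def boundary {P : GammaComplex Γ} {L : Rep.{0} ℤ Γ} {m : ℕ}
    (c : OrderedSimplex P.K (m + 1) → L) (τ : OrderedSimplex P.K m) : L :=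
  ∑ i : Fin (m + 2), (-1 : ℤ) ^ (i : ℕ) •
    ∑ᶠ (σ : OrderedSimplex P.K (m + 1)) (_ : σ.face i = τ), c σ

/-- `c` is a cycle: `∂ c = 0` (every `0`-chain is a cycle). -/
def IsCycle {P : GammaComplex Γ} {L : Rep.{0} ℤ Γ} :
    {m : ℕ} → (OrderedSimplex P.K m → L) → Prop
  | 0, _ => True
  | _ + 1, c => boundary c = 0

end Chains

/-! ### Integral singular cohomology with compact supports -/

section Singular

variable (X : Type) [TopologicalSpace X]

/-- Singular `n`-simplices of `X`. -/
abbrev SingularSimplex (n : ℕ) : Type := C(stdSimplex ℝ (Fin (n + 1)), X)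

/-- The `i`-th face of a singular simplex. -/
def SingularSimplex.face {X : Type} [TopologicalSpace X] {n : ℕ} (i : Fin (n + 2))
    (s : SingularSimplex X (n + 1)) : SingularSimplex X n :=
  s.comp ⟨stdSimplex.map i.succAbove, stdSimplex.continuous_map _⟩

/-- Integral singular `n`-cochains of `X`, as functions on singular simplices. -/
abbrev SingularCochain (n : ℕ) : Type := SingularSimplex X n → ℤ

/-- The singular coboundary, `(δ ω)(s) = ω(∂ s)`. -/
def singularCoboundary (n : ℕ) : SingularCochain X n →+ SingularCochain X (n + 1) where
  toFun ω s := ∑ i : Fin (n + 2), (-1 : ℤ) ^ (i : ℕ) * ω (s.face i)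
  map_zero' := by ext s; simp
  map_add' ω η := by ext s; simp [mul_add, Finset.sum_add_distrib]

/-- Singular cochains with compact support: those vanishing on all singular simplices in the
complement of some compact set. -/
def compactCochains (n : ℕ) : AddSubgroup (SingularCochain X n) where
  carrier := {ω | ∃ B : Set X, IsCompact B ∧
    ∀ s : SingularSimplex X n, (∀ t, s t ∉ B) → ω s = 0}
  zero_mem' := ⟨∅, isCompact_empty, fun _ _ => rfl⟩
  add_mem' := by
    rintro a b ⟨A, hA, ha⟩ ⟨B, hB, hb⟩
    refine ⟨A ∪ B, hA.union hB, fun s hs => ?_⟩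
    simp [ha s fun t ht => hs t (Or.inl ht), hb s fun t ht => hs t (Or.inr ht)]
  neg_mem' := by
    rintro a ⟨A, hA, ha⟩
    exact ⟨A, hA, fun s hs => by simp [ha s hs]⟩

/-- Cocycles with compact support. -/
def compactCocycles (n : ℕ) : AddSubgroup (SingularCochain X n) :=
  compactCochains X n ⊓ (singularCoboundary X n).ker

/-- Coboundaries of cochains with compact support. -/
def compactCoboundaries : (n : ℕ) → AddSubgroup (SingularCochain X n)
  | 0 => ⊥
  | n + 1 => (compactCochains X n).map (singularCoboundary X n)

/-- Singular cohomology with compact supports `Hⁿ_c(X; ℤ)`. -/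
abbrev CompactCohomology (n : ℕ) : Type :=
  compactCocycles X n ⧸ (compactCoboundaries X n).addSubgroupOf (compactCocycles X n)

/-- The class of a compactly supported cocycle generates `Hⁿ_c(X; ℤ)`. -/
def IsGenerator {X : Type} [TopologicalSpace X] {n : ℕ} (ω : compactCocycles X n) : Prop :=
  AddSubgroup.zmultiples (QuotientAddGroup.mk ω : CompactCohomology X n) = ⊤

end Singular

/-! ### The map `α` and its extension -/

section Alpha

variable {Γ : Type} [Group Γ]

/-- The word length of `g` with respect to `S`. -/
def wordLength (S : Finset Γ) (g : Γ) : ℕ :=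
  sInf {m | ∃ l : List Γ, l.length = m ∧ (∀ x ∈ l, x ∈ S ∨ x⁻¹ ∈ S) ∧ l.prod = g}

/-- The (left-invariant) word metric `d(g, h) = |g⁻¹ h|` with respect to `S`. -/
def wordDist (S : Finset Γ) (g h : Γ) : ℕ := wordLength S (g⁻¹ * h)

/-- Conditions (1)–(3) on a continuous map `α : Γ × P → ℝⁿ`, with `Γ` discrete. -/
structure IsLipschitzMap (S : Finset Γ) {P : GammaComplex Γ} {n : ℕ}
    (α : Γ → C(P.Space, EuclideanSpace ℝ (Fin n))) : Prop where
  invariant : ∀ (γ g : Γ) (x : P.Space), α (γ * g) (GammaComplex.smulPoint γ x) = α g x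
  proper : ∀ g : Γ, IsProperMap (α g)
  lipschitz : ∀ (x : P.Space) (g h : Γ), dist (α g x) (α h x) ≤ wordDist S g h

variable {P : GammaComplex Γ} {n : ℕ} (α : Γ → C(P.Space, EuclideanSpace ℝ (Fin n)))

/-- The extension `ᾱ : Δ^∞(Γ) × P → ℝⁿ`, `ᾱ(∑ tᵢ γᵢ, x) = ∑ tᵢ α(γᵢ, x)`. -/
def alphaBar (μ : Γ →₀ ℝ) (x : P.Space) : EuclideanSpace ℝ (Fin n) :=
  μ.sum fun g r => r • α g x

/-- The restriction of `ᾱ` to `Δ × σ`, with `Δ = [γ₀, …, γₖ]` and `σ` a simplex of `P`, in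
barycentric coordinates. -/
def alphaBarRestrict {k l : ℕ} (Δ : Fin (k + 1) → Γ) (σ : OrderedSimplex P.K l) :
    C(stdSimplex ℝ (Fin (k + 1)) × stdSimplex ℝ (Fin (l + 1)), EuclideanSpace ℝ (Fin n)) where
  toFun p := alphaBar α (baryPoint Δ p.1) (σ.charMap p.2)
  continuous_toFun := by
    simp only [alphaBar, baryPoint_linear]
    refine continuous_finsetSum _ fun i _ => ?_
    have h₁ : Continuous fun p : stdSimplex ℝ (Fin (k + 1)) × stdSimplex ℝ (Fin (l + 1)) => p.1 i :=
      (continuous_apply i).comp (continuous_subtype_val.comp continuous_fst)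
    have h₂ : Continuous fun p : stdSimplex ℝ (Fin (k + 1)) × stdSimplex ℝ (Fin (l + 1)) =>
        α (Δ i) (σ.charMap p.2) :=
      (α (Δ i)).continuous.comp (σ.continuous_charMap.comp continuous_snd)
    exact h₁.smul h₂

/-- The top-dimensional simplices of the staircase triangulation of `Δᵏ × Δˡ`: the maximal chains
of `{0, …, k} × {0, …, l}`. -/
abbrev Staircase (k l : ℕ) : Type :=
  {p : Fin (k + l + 1) → Fin (k + 1) × Fin (l + 1) // StrictMono p}

instance (k l : ℕ) : Fintype (Staircase k l) := Fintype.ofFinite _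

/-- The orientation sign of a staircase, `-1` to the number of unit squares below it (the sign of
the corresponding shuffle). -/
def Staircase.sign {k l : ℕ} (p : Staircase k l) : ℤ :=
  (-1) ^ ∑ j : Fin (k + l),
    (((p.1 j.succ).1 : ℕ) - ((p.1 j.castSucc).1 : ℕ)) * ((p.1 j.castSucc).2 : ℕ)

/-- The affine embedding `Δᵏ⁺ˡ → Δᵏ × Δˡ` onto a simplex of the staircase triangulation. -/
def Staircase.embed {k l : ℕ} (p : Staircase k l) :
    C(stdSimplex ℝ (Fin (k + l + 1)), stdSimplex ℝ (Fin (k + 1)) × stdSimplex ℝ (Fin (l + 1))) where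
  toFun t := (stdSimplex.map (fun j => (p.1 j).1) t, stdSimplex.map (fun j => (p.1 j).2) t)
  continuous_toFun := (stdSimplex.continuous_map _).prodMk (stdSimplex.continuous_map _)

/-- `φ(Δ ⊗ σ) = ω(ᾱ|Δ×σ)`, where `ᾱ|Δ×σ` is the singular chain given by the staircase
triangulation. -/
def phi {k l : ℕ} (α : Γ → C(P.Space, EuclideanSpace ℝ (Fin (k + l))))
    (ω : SingularCochain (EuclideanSpace ℝ (Fin (k + l))) (k + l))
    (Δ : Fin (k + 1) → Γ) (σ : OrderedSimplex P.K l) : ℤ :=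
  ∑ p : Staircase k l, p.sign * ω ((alphaBarRestrict α Δ σ).comp p.embed)

/-- The slant product `(φ̄/z)(Δ) = ∑_σ φ(Δ ⊗ σ) λ_σ` for `z = ∑_σ λ_σ σ` (a homogeneous cochain on
`Γ`). The sum is finite when `α` satisfies (1)–(3), `ω` has compact support and `P` is locally
finite. -/
def slant {L : Rep.{0} ℤ Γ} {k l : ℕ} (α : Γ → C(P.Space, EuclideanSpace ℝ (Fin (k + l))))
    (ω : SingularCochain (EuclideanSpace ℝ (Fin (k + l))) (k + l))
    (z : OrderedSimplex P.K l → L) (Δ : Fin (k + 1) → Γ) : L :=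
  ∑ᶠ σ : OrderedSimplex P.K l, phi α ω Δ σ • z σ

end Alpha

/-- Passage from homogeneous to inhomogeneous cochains:
`f(g₁, …, gₖ) = c(1, g₁, g₁g₂, …, g₁⋯gₖ)`. -/
def dehomogenize {Γ : Type} [Group Γ] {L : Type} {k : ℕ} (c : (Fin (k + 1) → Γ) → L) :
    (Fin k → Γ) → L :=
  fun g => c (Fin.partialProd g)

/-- `a ∈ Hᵏ(Γ, L)` is a proper Lipschitz class (`S` a finite generating set of `Γ`, used for the
word metric): there are a parameter complex `P`, a map `α : Γ × P → ℝⁿ` with (1)–(3), `n = k + l`,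
a cocycle `ω` generating `Hⁿ_c(ℝⁿ; ℤ)` and an infinite invariant cycle `z ∈ Z_l(P : Γ; L)` with
`a = α_∩([z])`, that is, `a` is represented by the cocycle `φ̄/z`. -/
def IsProperLipschitz {Γ : Type} [Group Γ] (S : Finset Γ) (L : Rep.{0} ℤ Γ) (k : ℕ)
    (a : groupCohomology L k) : Prop :=
  ∃ (P : GammaComplex Γ) (l : ℕ) (α : Γ → C(P.Space, EuclideanSpace ℝ (Fin (k + l))))
    (ω : compactCocycles (EuclideanSpace ℝ (Fin (k + l))) (k + l))
    (z : invariantChains P L l) (c : groupCohomology.cocycles L k),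
    P.IsAdmissible ∧ IsLipschitzMap S α ∧ IsGenerator ω ∧ IsCycle z.1 ∧
      groupCohomology.iCocycles L k c = dehomogenize (slant α ω.1 z.1) ∧
      groupCohomology.π L k c = a

end ProperLipschitz

end

namespace ProperLipschitz

open CategoryTheory

section LocallyFinite

variable {V : Type} {K : AbstractSimplicialComplex V}

/-- In a locally finite complex a vertex lies in only finitely many ordered simplices. -/
lemma finite_orderedSimplex_of_vertex (hK : ∀ v : V, {s ∈ K.faces | v ∈ s}.Finite)
    (m : ℕ) (v : V) : {σ : OrderedSimplex K m | ∃ i, σ.1 i = v}.Finite := by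
  have hfin : (⋃ s ∈ {s ∈ K.faces | v ∈ s},
      {w : Fin (m + 1) → V | ∀ i, w i ∈ (s : Set V)}).Finite :=
    (hK v).biUnion fun s _ => Set.Finite.pi' fun _ => s.finite_toSet
  refine (hfin.preimage Subtype.val_injective.injOn).subset ?_
  rintro σ ⟨i, rfl⟩
  obtain ⟨s, hs, h⟩ := σ.2
  exact Set.mem_biUnion (show s ∈ {s ∈ K.faces | σ.1 i ∈ s} from ⟨hs, h i⟩) h

lemma finite_face_fiber (hK : ∀ v : V, {s ∈ K.faces | v ∈ s}.Finite) {m : ℕ}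
    (i : Fin (m + 2)) (τ : OrderedSimplex K m) :
    {σ : OrderedSimplex K (m + 1) | σ.face i = τ}.Finite := by
  refine (finite_orderedSimplex_of_vertex hK (m + 1) (τ.1 0)).subset ?_
  rintro σ rfl
  exact ⟨i.succAbove 0, rfl⟩

/-- Open stars of vertices are open in the weak topology. -/
lemma isOpen_openStar (v : V) : IsOpen {x : Realization K | 0 < x.1 v} := by
  refine isOpen_iSup_iff.2 fun m => isOpen_iSup_iff.2 fun σ => isOpen_coinduced.2 ?_
  classical
  have hc : Continuous fun t : stdSimplex ℝ (Fin (m + 1)) => (σ.charMap t).1 v := by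
    simp only [OrderedSimplex.charMap, baryPoint, Finsupp.finsetSum_apply, Finsupp.single_apply]
    refine continuous_finsetSum _ fun i _ => ?_
    split_ifs
    · exact (continuous_apply i).comp continuous_subtype_val
    · exact continuous_const
  exact isOpen_lt continuous_const hc

lemma exists_coord_pos (x : Realization K) : ∃ v, 0 < x.1 v := by
  by_contra! h
  have h0 : x.1 = 0 := Finsupp.ext fun v => le_antisymm (h v) (x.2.1 v)
  have h1 := x.2.2.1
  rw [h0, Finsupp.sum_zero_index] at h1
  exact zero_ne_one h1

lemma OrderedSimplex.exists_vertex_eq {m : ℕ} (σ : OrderedSimplex K m)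
    (t : stdSimplex ℝ (Fin (m + 1))) {v : V} (hv : 0 < (σ.charMap t).1 v) :
    ∃ i, σ.1 i = v := by
  classical
  by_contra! h
  refine hv.ne' ?_
  simp [OrderedSimplex.charMap, baryPoint, Finsupp.finsetSum_apply, h]

/-- In a locally finite complex a compact set meets only finitely many ordered simplices. -/
lemma finite_orderedSimplex_meeting_compact (hK : ∀ v : V, {s ∈ K.faces | v ∈ s}.Finite)
    (m : ℕ) {C : Set (Realization K)} (hC : IsCompact C) :
    {σ : OrderedSimplex K m | ∃ t, σ.charMap t ∈ C}.Finite := by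
  obtain ⟨F, hF⟩ := hC.elim_finite_subcover (fun v : V => {x : Realization K | 0 < x.1 v})
    isOpen_openStar fun x _ => Set.mem_iUnion.2 (exists_coord_pos x)
  refine (F.finite_toSet.biUnion fun v _ => finite_orderedSimplex_of_vertex hK m v).subset ?_
  rintro σ ⟨t, ht⟩
  obtain ⟨v, hvF, hv⟩ := Set.mem_iUnion₂.1 (hF ht)
  exact Set.mem_biUnion hvF (σ.exists_vertex_eq t hv)

end LocallyFinite

section Slant

variable {Γ : Type} [Group Γ] {P : GammaComplex Γ}

/-- On `[γ₀, …, γₖ] × P` the map `ᾱ` stays within bounded distance of `α(γ₀, ·)`. -/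
lemma dist_alphaBar_baryPoint_le {S : Finset Γ} {n : ℕ}
    {α : Γ → C(P.Space, EuclideanSpace ℝ (Fin n))} (hα : IsLipschitzMap S α) {k : ℕ}
    (Δ : Fin (k + 1) → Γ) (t : stdSimplex ℝ (Fin (k + 1))) (x : P.Space) :
    dist (α (Δ 0) x) (alphaBar α (baryPoint Δ t) x) ≤ ∑ i, (wordDist S (Δ i) (Δ 0) : ℝ) := by
  have hsum : α (Δ 0) x = ∑ i, t i • α (Δ 0) x := by
    rw [← Finset.sum_smul]
    exact (by rw [show ∑ i, t i = 1 from t.2.2, one_smul])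
  rw [alphaBar, baryPoint_linear, hsum, dist_comm]
  refine (dist_sum_sum_le _ _ _).trans (Finset.sum_le_sum fun i _ => ?_)
  have h0 : 0 ≤ t i := t.2.1 i
  have h1 : t i ≤ 1 := (Finset.single_le_sum (f := fun i => t i)
    (fun j _ => t.2.1 j) (Finset.mem_univ i)).trans_eq t.2.2
  rw [dist_smul₀, Real.norm_of_nonneg h0]
  exact (mul_le_of_le_one_left dist_nonneg h1).trans (hα.lipschitz x _ _)

/-- For fixed `Δ`, `φ(Δ ⊗ σ)` vanishes for all but finitely many `σ`. -/
lemma finite_support_phi (hP : ∀ v : P.V, {s ∈ P.K.faces | v ∈ s}.Finite) {S : Finset Γ}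
    {k l : ℕ} {α : Γ → C(P.Space, EuclideanSpace ℝ (Fin (k + l)))} (hα : IsLipschitzMap S α)
    {ω : SingularCochain (EuclideanSpace ℝ (Fin (k + l))) (k + l)}
    (hω : ω ∈ compactCochains (EuclideanSpace ℝ (Fin (k + l))) (k + l)) (Δ : Fin (k + 1) → Γ) :
    (Function.support fun σ : OrderedSimplex P.K l => phi α ω Δ σ).Finite := by
  obtain ⟨B, hB, hωB⟩ := hω
  have hC := (hα.proper (Δ 0)).isCompact_preimage
    (hB.cthickening (r := ∑ i, (wordDist S (Δ i) (Δ 0) : ℝ)))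
  refine (finite_orderedSimplex_meeting_compact hP l hC).subset fun σ hσ => ?_
  obtain ⟨p, -, hp⟩ := Finset.exists_ne_zero_of_sum_ne_zero hσ
  have hne : ω ((alphaBarRestrict α Δ σ).comp p.embed) ≠ 0 := right_ne_zero_of_mul hp
  obtain ⟨t, ht⟩ := not_forall_not.1 fun h => hne (hωB _ h)
  exact ⟨(p.embed t).2, Metric.mem_cthickening_of_dist_le _ _ _ _ ht
    (dist_alphaBar_baryPoint_le hα Δ _ _)⟩

variable {L L' : Rep.{0} ℤ Γ}

lemma boundary_map (hP : ∀ v : P.V, {s ∈ P.K.faces | v ∈ s}.Finite) (f : L →+ L') {m : ℕ}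
    (c : OrderedSimplex P.K (m + 1) → L) (τ : OrderedSimplex P.K m) :
    boundary (L := L') (fun σ => f (c σ)) τ = f (boundary c τ) := by
  simp only [boundary, map_sum, map_zsmul]
  refine Finset.sum_congr rfl fun i _ => congrArg _ ?_
  exact (f.map_finsum_mem c (finite_face_fiber hP i τ)).symm

lemma IsCycle.map (hP : ∀ v : P.V, {s ∈ P.K.faces | v ∈ s}.Finite) (f : L →+ L') :
    ∀ {m : ℕ} {c : OrderedSimplex P.K m → L}, IsCycle c →
      IsCycle (L := L') (fun σ => f (c σ))
  | 0, _, _ => trivial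
  | _ + 1, c, hc => funext fun τ => by
    rw [boundary_map hP, show boundary c = 0 from hc]
    exact map_zero f

lemma slant_map {k l : ℕ} {α : Γ → C(P.Space, EuclideanSpace ℝ (Fin (k + l)))}
    {ω : SingularCochain (EuclideanSpace ℝ (Fin (k + l))) (k + l)} {Δ : Fin (k + 1) → Γ}
    (hφ : (Function.support fun σ : OrderedSimplex P.K l => phi α ω Δ σ).Finite)
    (f : L →+ L') (z : OrderedSimplex P.K l → L) :
    slant (L := L') α ω (fun σ => f (z σ)) Δ = f (slant α ω z Δ) := by
  have hfin : (Function.support fun σ => phi α ω Δ σ • z σ).Finite :=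
    hφ.subset fun σ hσ h0 => hσ <| by
      simp only at h0 ⊢
      rw [h0, zero_smul]
  rw [slant, slant, f.map_finsum hfin]
  simp only [map_zsmul]

/-- The additive map underlying a homomorphism of representations. -/
def addHom (h : L ⟶ L') : L →+ L' :=
  AddMonoidHom.mk' (fun x => h.hom x) fun x y => map_add h.hom x y

/-- The chain map induced by a homomorphism of coefficient modules. -/
def mapInvariantChains (h : L ⟶ L') {m : ℕ} (z : invariantChains P L m) :
    invariantChains P L' m :=
  ⟨fun σ => addHom h (z.1 σ), fun γ σ =>
    (congrArg h.hom (z.2 γ σ)).trans (Rep.hom_comm_apply h γ (z.1 σ))⟩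

end Slant

lemma iCocycles_cocyclesMap_id {Γ : Type} [Group Γ] {L L' : Rep.{0} ℤ Γ} (h : L ⟶ L') {k : ℕ}
    (c : groupCohomology.cocycles L k) (g : Fin k → Γ) :
    (groupCohomology.iCocycles L' k
      (groupCohomology.cocyclesMap (MonoidHom.id Γ) h k c) : (Fin k → Γ) → L') g =
      h.hom ((groupCohomology.iCocycles L k c : (Fin k → Γ) → L) g) :=
  congrFun (ConcreteCategory.congr_hom
    (HomologicalComplex.cyclesMap_i (groupCohomology.cochainsMap (MonoidHom.id Γ) h) k) c) g

end ProperLipschitz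

open CategoryTheory ProperLipschitz in
theorem mainTheorem2 {Γ : Type} [Group Γ] (S : Finset Γ)
    (hS : Subgroup.closure (S : Set Γ) = ⊤) (L L' : Rep.{0} ℤ Γ) (h : L ⟶ L') (k : ℕ)
    (a : groupCohomology L k) (ha : ProperLipschitz.IsProperLipschitz S L k a) :
    ProperLipschitz.IsProperLipschitz S L' k
      ((groupCohomology.functor ℤ Γ k).map h a) := by
  obtain ⟨P, l, α, ω, z, c, hP, hα, hω, hz, hc, rfl⟩ := ha
  refine ⟨P, l, α, ω, mapInvariantChains h z,
    groupCohomology.cocyclesMap (MonoidHom.id Γ) h k c, hP, hα, hω,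
    hz.map hP.locallyFinite (addHom h), ?_, ?_⟩
  · funext g
    refine (iCocycles_cocyclesMap_id h c g).trans ?_
    rw [hc]
    exact (slant_map (finite_support_phi hP.locallyFinite hα ω.2.1 _)
      (addHom h) z.1).symm
  · exact (ConcreteCategory.congr_hom
      (groupCohomology.π_map (MonoidHom.id Γ) h k) c).symm
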